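/- Let $\Bbbk$ be a field. For a module $X$ over a $\Bbbk$-algebra $R$ let $\mathrm{GK}(X)=\sup_{V,F}\limsup_n \log_n\dim_\Bbbk(V^nF)$ be its Gelfand–Kirillov dimension ($V\ni 1$ and $F$ run over the finite-dimensional subspaces of $R$ and $X$; $\mathrm{GK}(0)=-\infty$), and let $j_R(X)=\inf\{i:\mathrm{Ext}^i_R(X,R)\ne0\}$. A (two-sided) noetherian algebra $R$ is *Auslander regular* if it has finite global dimension and, for every finitely generated left or right $R$-module $X$, every $q\ge 0$ and every submodule $Y\subseteq\mathrm{Ext}^q_R(X,R)$ on the other side, $j_R(Y)\ge q$; it is *CM* if $\mathrm{GK}(R)\in\mathbb N$ and $j_R(X)+\mathrm{GK}(X)=\mathrm{GK}(R)$ for every nonzero finitely generated left or right $R$-module $X$. Bimodules are $\Bbbk$-central. Two $(D,R)$-bimodules $X,Y$ are *$s$-isomorphic*, $X\cong_s Y$, if there are a $(D,R)$-bimodule $P$ and bimodule maps $X\to P$, $Y\to P$ whose kernels and cokernels have $\mathrm{GK}\le s$ as right $R$-modules; *as graded bimodules* means that $P$ is $\mathbb Z$-graded and the maps preserve degrees.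 Let $A$ be a noetherian algebra with $\mathrm{GK}(A)=d\in\mathbb N$, $d\ge2$. A *noncommutative quasi-resolution* (NQR) of $A$ is a triple $(B,M,N)$ of a noetherian Auslander regular CM algebra $B$ with $\mathrm{GK}(B)=d$, a $(B,A)$-bimodule $M$ and an $(A,B)$-bimodule $N$, both finitely generated on both sides, such that $M\otimes_AN\cong_{d-2}B$ and $N\otimes_BM\cong_{d-2}A$ as bimodules. It is a *graded NQR* of $A$ if moreover $A$ and $B$ are locally finite $\mathbb N$-graded algebras (every homogeneous component is finite-dimensional), $M$ and $N$ are $\mathbb Z$-graded bimodules, and both $(d-2)$-isomorphisms are as graded bimodules. **Proposition 8.3.** Let $B$ be a noetherian locally finite $\mathbb N$-graded $\Bbbk$-algebra which is Auslander regular and CM with $\mathrm{GK}(B)=d\ge 2$. Let $e\in B$ be an idempotent and $A=eBe$. Suppose that the $(B,A)$-bimodule $Be$ and the $(A,B)$-bimodule $eB$ are finitely generated on both sides and that $\mathrm{GK}(B/BeB)\le d-2$. Then $(B,Be,eB)$ is an NQR of $A$. If moreover $e\in B_0$, then $(B,Be,eB)$ is a graded NQR of $A$, where $A$, $Be$ and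 $eB$ carry the gradings induced from $B$. -/

import Mathlib

open scoped TensorProduct ENNReal
open MulOpposite

namespace QuasiRes

universe u v

/-! ### Conventions

`k` is the base field.  Left `R`-modules are `Module R M`; right `R`-modules are `Module Rᵐᵒᵖ M`.
A `(D, A)`-bimodule is a left `D`-module which is a right `A`-module, the two actions commuting and
inducing the same action of `k`. -/

/-! ### Gelfand-Kirillov dimension -/

section GK

variable (k : Type u) [Field k] (R : Type v) [Ring R] [Algebra k R]

/-- The Gelfand-Kirillov dimension of an `R`-module `M`:
the supremum of `limsup_n log_n dim_k (V ^ n F)` over the finite-dimensional subspaces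
`V ∋ 1` of `R` and `F` of `M`.  It is `⊥ = -∞` exactly for the zero module.
For a right `R`-module, take `Rᵐᵒᵖ` as the ring.
The dimension of an algebra is that of the algebra as a module over itself. -/
noncomputable def gkDim (M : Type*) [AddCommGroup M] [Module k M] [Module R M]
    [IsScalarTower k R M] : EReal :=
  ⨆ (V : Submodule k R) (F : Submodule k M) (_ : (1 : R) ∈ V) (_ : V.FG) (_ : F.FG),
    Filter.limsup
      (fun n : ℕ =>
        ENNReal.log ((Module.finrank k ↥(V ^ n • F) : ℕ) : ℝ≥0∞) / ((Real.log n : ℝ) : EReal))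
      Filter.atTop

end GK

/-! ### Homological conditions -/

section Homological

open CategoryTheory CategoryTheory.Abelian

variable (R : Type v) [Ring R]

/-- Right multiplication by an element of `R`, as an endomorphism of the left `R`-module `R`. -/
def rightMul (r : Rᵐᵒᵖ) : R →ₗ[R] R where
  toFun x := x * unop r
  map_add' x y := add_mul x y _
  map_smul' a x := mul_assoc a x _

/-- `Ext^q_R(M, R)` for a left `R`-module `M`. -/
abbrev ExtRing (M : Type v) [AddCommGroup M] [Module R M] (q : ℕ) : Type v :=
  Ext (ModuleCat.of R M) (ModuleCat.of R R) q

/-- The additive endomorphism of `Ext^q_R(M, R)` induced by right multiplication by `r` on `R`. -/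
noncomputable def extRightMul (M : Type v) [AddCommGroup M] [Module R M] (q : ℕ) :
    Rᵐᵒᵖ →+* AddMonoid.End (ExtRing R M q) where
  toFun r :=
    { toFun := fun α => α.comp (Ext.mk₀ (ModuleCat.ofHom (rightMul R r))) (add_zero q)
      map_zero' := Ext.zero_comp _ _ _ _ (add_zero q)
      map_add' := fun α β => Ext.add_comp α β _ _ }
  map_one' := by
    refine AddMonoidHom.ext fun α => ?_
    have h : ModuleCat.ofHom (rightMul R 1) = 𝟙 (ModuleCat.of R R) := by
      apply ModuleCat.hom_ext
      refine LinearMap.ext fun (x : R) => ?_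
      change x * 1 = x
      exact mul_one x
    change α.comp (Ext.mk₀ (ModuleCat.ofHom (rightMul R 1))) (add_zero q) = α
    rw [h, Ext.comp_mk₀_id]
  map_zero' := by
    refine AddMonoidHom.ext fun α => ?_
    have h : ModuleCat.ofHom (rightMul R 0) = (0 : ModuleCat.of R R ⟶ ModuleCat.of R R) := by
      apply ModuleCat.hom_ext
      refine LinearMap.ext fun (x : R) => ?_
      change x * 0 = 0
      exact mul_zero x
    change α.comp (Ext.mk₀ (ModuleCat.ofHom (rightMul R 0))) (add_zero q) = 0
    rw [h, Ext.mk₀_zero, Ext.comp_zero]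
  map_add' r s := by
    refine AddMonoidHom.ext fun α => ?_
    have h : ModuleCat.ofHom (rightMul R (r + s)) =
        ModuleCat.ofHom (rightMul R r) + ModuleCat.ofHom (rightMul R s) := by
      apply ModuleCat.hom_ext
      refine LinearMap.ext fun (x : R) => ?_
      change x * (unop r + unop s) = x * unop r + x * unop s
      exact mul_add _ _ _
    change α.comp (Ext.mk₀ (ModuleCat.ofHom (rightMul R (r + s)))) (add_zero q) =
      α.comp (Ext.mk₀ (ModuleCat.ofHom (rightMul R r))) (add_zero q) +
      α.comp (Ext.mk₀ (ModuleCat.ofHom (rightMul R s))) (add_zero q)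
    rw [h, Ext.mk₀_add, Ext.comp_add]
  map_mul' r s := by
    refine AddMonoidHom.ext fun α => ?_
    have h : ModuleCat.ofHom (rightMul R (r * s)) =
        ModuleCat.ofHom (rightMul R s) ≫ ModuleCat.ofHom (rightMul R r) := by
      apply ModuleCat.hom_ext
      refine LinearMap.ext fun (x : R) => ?_
      change x * (unop s * unop r) = x * unop s * unop r
      exact (mul_assoc _ _ _).symm
    change α.comp (Ext.mk₀ (ModuleCat.ofHom (rightMul R (r * s)))) (add_zero q) =
      (α.comp (Ext.mk₀ (ModuleCat.ofHom (rightMul R s))) (add_zero q)).comp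
        (Ext.mk₀ (ModuleCat.ofHom (rightMul R r))) (add_zero q)
    rw [h, ← Ext.mk₀_comp_mk₀, Ext.comp_assoc_of_third_deg_zero]

/-- The right `R`-module structure of `Ext^q_R(M, R)`. -/
noncomputable instance extRingModule (M : Type v) [AddCommGroup M] [Module R M] (q : ℕ) :
    Module Rᵐᵒᵖ (ExtRing R M q) :=
  Module.compHom _ (extRightMul R M q)

/-- The grade number `j_R(M) = inf {i | Ext^i_R(M, R) ≠ 0}` of a left `R`-module,
with `inf ∅ = +∞`. -/
noncomputable def gradeNumber (M : Type v) [AddCommGroup M] [Module R M] : ℕ∞ :=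
  ⨅ (i : ℕ) (_ : Nontrivial (ExtRing R M i)), (i : ℕ∞)

/-- Every finitely generated left `R`-module satisfies the Auslander condition:
`j(N) ≥ q` for every `q` and every right `R`-submodule `N` of `Ext^q_R(M, R)`. -/
def LeftAuslander : Prop :=
  ∀ (M : Type v) [AddCommGroup M] [Module R M] [Module.Finite R M] (q : ℕ)
    (N : Submodule Rᵐᵒᵖ (ExtRing R M q)), (q : ℕ∞) ≤ gradeNumber Rᵐᵒᵖ ↥N

/-- Every left `R`-module has projective dimension at most `n`. -/
def LeftGlobalDimLE (n : ℕ) : Prop :=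
  ∀ M : ModuleCat.{v} R, HasProjectiveDimensionLE M n

/-- Auslander regular rings: finite global dimension, and all finitely generated left and right
modules satisfy the Auslander condition.  A right `R`-module is a left `Rᵐᵒᵖ`-module; left and
right modules over `Rᵐᵒᵖᵐᵒᵖ` are left and right modules over `R`. -/
structure IsAuslanderRegular : Prop where
  left_gldim : ∃ n, LeftGlobalDimLE R n
  right_gldim : ∃ n, LeftGlobalDimLE Rᵐᵒᵖ n
  left_auslander : LeftAuslander R
  right_auslander : LeftAuslander Rᵐᵒᵖ

variable (k : Type u) [Field k] [Algebra k R]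

/-- `j(M) + GK(M) = d` for every nonzero finitely generated left `R`-module `M`. -/
def LeftCM (d : ℕ) : Prop :=
  ∀ (M : Type v) [AddCommGroup M] [Module k M] [Module R M] [IsScalarTower k R M]
    [Module.Finite R M] [Nontrivial M],
    ((gradeNumber R M : ℝ≥0∞) : EReal) + gkDim k R M = (d : EReal)

/-- `R` is (`GK`-)Cohen-Macaulay with `GK(R) = d`. -/
structure IsCohenMacaulay (d : ℕ) : Prop where
  gkDim_eq : gkDim k Rᵐᵒᵖ R = (d : EReal)
  left_cm : LeftCM R k d
  right_cm : LeftCM Rᵐᵒᵖ k d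

end Homological

/-! ### Tensor products of bimodules over a noncommutative ring -/

section BalTensor

variable (k : Type u) [Field k] (A : Type*) [Ring A] [Algebra k A]
  (M : Type*) [AddCommGroup M] [Module k M] [Module Aᵐᵒᵖ M] [IsScalarTower k Aᵐᵒᵖ M]
  (N : Type*) [AddCommGroup N] [Module k N] [Module A N] [IsScalarTower k A N]

/-- The subspace of `M ⊗[k] N` spanned by all `m a ⊗ n - m ⊗ a n`. -/
def balancedRel : Submodule k (M ⊗[k] N) :=
  Submodule.span k {t | ∃ (m : M) (a : A) (n : N), t = (op a • m) ⊗ₜ[k] n - m ⊗ₜ[k] (a • n)}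

/-- The tensor product `M ⊗_A N` of a right and a left module over the `k`-algebra `A`. -/
def BalTensor : Type _ := (M ⊗[k] N) ⧸ balancedRel k A M N

namespace BalTensor

instance instAddCommGroup : AddCommGroup (BalTensor k A M N) :=
  inferInstanceAs (AddCommGroup ((M ⊗[k] N) ⧸ balancedRel k A M N))

instance instModuleBase : Module k (BalTensor k A M N) :=
  inferInstanceAs (Module k ((M ⊗[k] N) ⧸ balancedRel k A M N))

/-- The canonical map from the tensor product over `k`. -/
def mk : (M ⊗[k] N) →ₗ[k] BalTensor k A M N := (balancedRel k A M N).mkQ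

variable {M N} in
/-- The pure tensor `m ⊗ n` in `M ⊗_A N`. -/
def tmul (m : M) (n : N) : BalTensor k A M N := mk k A M N (m ⊗ₜ[k] n)

theorem mk_surjective : Function.Surjective (mk k A M N) := Submodule.mkQ_surjective _

/-- Endomorphisms of `M ⊗[k] N` preserving the relations descend. -/
def descend (f : Module.End k (M ⊗[k] N))
    (hf : balancedRel k A M N ≤ (balancedRel k A M N).comap f) :
    Module.End k (BalTensor k A M N) :=
  Submodule.mapQ (balancedRel k A M N) (balancedRel k A M N) f hf

variable {k A M N} in
@[simp]
theorem descend_mk (f : Module.End k (M ⊗[k] N))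
    (hf : balancedRel k A M N ≤ (balancedRel k A M N).comap f) (t : M ⊗[k] N) :
    descend k A M N f hf (mk k A M N t) = mk k A M N (f t) := rfl

variable {k A M N} in
theorem end_ext {f g : Module.End k (BalTensor k A M N)}
    (h : ∀ t, f (mk k A M N t) = g (mk k A M N t)) : f = g := by
  refine LinearMap.ext fun x => ?_
  obtain ⟨t, rfl⟩ := mk_surjective k A M N x
  exact h t

section Left

variable (D : Type*) [Ring D] [Algebra k D] [Module D M] [IsScalarTower k D M]
  [SMulCommClass D Aᵐᵒᵖ M]

/-- The left action of `D` on `M ⊗_A N` through `M`. -/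
def leftAction : D →+* Module.End k (BalTensor k A M N) where
  toFun b := descend k A M N (LinearMap.rTensor N (Algebra.lsmul k k M b)) <| by
    refine Submodule.span_le.2 ?_
    rintro _ ⟨m, a, n, rfl⟩
    refine Submodule.subset_span ⟨b • m, a, n, ?_⟩
    simp [smul_comm b (op a) m]
  map_one' := end_ext fun t => by
    change mk k A M N (LinearMap.rTensor N (Algebra.lsmul k k M 1) t) = mk k A M N t
    rw [map_one, Module.End.one_eq_id, LinearMap.rTensor_id, LinearMap.id_apply]
  map_zero' := end_ext fun t => by
    change mk k A M N (LinearMap.rTensor N (Algebra.lsmul k k M 0) t) = 0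
    rw [map_zero, LinearMap.rTensor_zero, LinearMap.zero_apply, map_zero]
  map_add' b c := end_ext fun t => by
    change mk k A M N (LinearMap.rTensor N (Algebra.lsmul k k M (b + c)) t) =
      mk k A M N (LinearMap.rTensor N (Algebra.lsmul k k M b) t) +
      mk k A M N (LinearMap.rTensor N (Algebra.lsmul k k M c) t)
    rw [map_add, LinearMap.rTensor_add, LinearMap.add_apply, map_add]
  map_mul' b c := end_ext fun t => by
    change mk k A M N (LinearMap.rTensor N (Algebra.lsmul k k M (b * c)) t) =
      mk k A M N (LinearMap.rTensor N (Algebra.lsmul k k M b)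
        (LinearMap.rTensor N (Algebra.lsmul k k M c) t))
    rw [map_mul, LinearMap.rTensor_mul, Module.End.mul_apply]

instance instModuleLeft : Module D (BalTensor k A M N) :=
  Module.compHom _ (leftAction k A M N D)

theorem smul_mk_left (b : D) (t : M ⊗[k] N) :
    b • mk k A M N t = mk k A M N (LinearMap.rTensor N (Algebra.lsmul k k M b) t) := rfl

theorem smul_tmul_left (b : D) (m : M) (n : N) :
    b • tmul k A m n = tmul k A (b • m) n := rfl

instance instIsScalarTowerLeft :
    @IsScalarTower k D (BalTensor k A M N) _ _ (instModuleBase k A M N).toSMul where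
  smul_assoc c b x := by
    obtain ⟨t, rfl⟩ := mk_surjective k A M N x
    change mk k A M N (LinearMap.rTensor N (Algebra.lsmul k k M (c • b)) t) =
      c • mk k A M N (LinearMap.rTensor N (Algebra.lsmul k k M b) t)
    rw [map_smul, LinearMap.rTensor_smul, LinearMap.smul_apply, map_smul]

end Left

section Right

variable (D : Type*) [Ring D] [Algebra k D] [Module Dᵐᵒᵖ N] [IsScalarTower k Dᵐᵒᵖ N]
  [SMulCommClass A Dᵐᵒᵖ N]

/-- The right action of `D` on `M ⊗_A N` through `N`. -/
def rightAction : Dᵐᵒᵖ →+* Module.End k (BalTensor k A M N) where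
  toFun b := descend k A M N (LinearMap.lTensor M (Algebra.lsmul k k N b)) <| by
    refine Submodule.span_le.2 ?_
    rintro _ ⟨m, a, n, rfl⟩
    refine Submodule.subset_span ⟨m, a, b • n, ?_⟩
    simp [smul_comm a b n]
  map_one' := end_ext fun t => by
    change mk k A M N (LinearMap.lTensor M (Algebra.lsmul k k N 1) t) = mk k A M N t
    rw [map_one, Module.End.one_eq_id, LinearMap.lTensor_id, LinearMap.id_apply]
  map_zero' := end_ext fun t => by
    change mk k A M N (LinearMap.lTensor M (Algebra.lsmul k k N 0) t) = 0
    rw [map_zero, LinearMap.lTensor_zero, LinearMap.zero_apply, map_zero]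
  map_add' b c := end_ext fun t => by
    change mk k A M N (LinearMap.lTensor M (Algebra.lsmul k k N (b + c)) t) =
      mk k A M N (LinearMap.lTensor M (Algebra.lsmul k k N b) t) +
      mk k A M N (LinearMap.lTensor M (Algebra.lsmul k k N c) t)
    rw [map_add, LinearMap.lTensor_add, LinearMap.add_apply, map_add]
  map_mul' b c := end_ext fun t => by
    change mk k A M N (LinearMap.lTensor M (Algebra.lsmul k k N (b * c)) t) =
      mk k A M N (LinearMap.lTensor M (Algebra.lsmul k k N b)
        (LinearMap.lTensor M (Algebra.lsmul k k N c) t))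
    rw [map_mul, LinearMap.lTensor_mul, Module.End.mul_apply]

instance instModuleRight : Module Dᵐᵒᵖ (BalTensor k A M N) :=
  Module.compHom _ (rightAction k A M N D)

theorem smul_mk_right (b : Dᵐᵒᵖ) (t : M ⊗[k] N) :
    b • mk k A M N t = mk k A M N (LinearMap.lTensor M (Algebra.lsmul k k N b) t) := rfl

theorem smul_tmul_right (b : Dᵐᵒᵖ) (m : M) (n : N) :
    b • tmul k A m n = tmul k A m (b • n) := rfl

instance instIsScalarTowerRight :
    @IsScalarTower k Dᵐᵒᵖ (BalTensor k A M N) _ _ (instModuleBase k A M N).toSMul where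
  smul_assoc c b x := by
    obtain ⟨t, rfl⟩ := mk_surjective k A M N x
    change mk k A M N (LinearMap.lTensor M (Algebra.lsmul k k N (c • b)) t) =
      c • mk k A M N (LinearMap.lTensor M (Algebra.lsmul k k N b) t)
    rw [map_smul, LinearMap.lTensor_smul, LinearMap.smul_apply, map_smul]

end Right

section Both

variable (D : Type*) [Ring D] [Algebra k D] [Module D M] [IsScalarTower k D M]
  [SMulCommClass D Aᵐᵒᵖ M]
  (E : Type*) [Ring E] [Algebra k E] [Module Eᵐᵒᵖ N] [IsScalarTower k Eᵐᵒᵖ N]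
  [SMulCommClass A Eᵐᵒᵖ N]

instance instSMulCommClass :
    @SMulCommClass D Eᵐᵒᵖ (BalTensor k A M N) (instModuleLeft k A M N D).toSMul
      (instModuleRight k A M N E).toSMul where
  smul_comm b c x := by
    obtain ⟨t, rfl⟩ := mk_surjective k A M N x
    change mk k A M N (LinearMap.rTensor N (Algebra.lsmul k k M b)
        (LinearMap.lTensor M (Algebra.lsmul k k N c) t)) =
      mk k A M N (LinearMap.lTensor M (Algebra.lsmul k k N c)
        (LinearMap.rTensor N (Algebra.lsmul k k M b) t))
    congr 1
    rw [← LinearMap.comp_apply, ← LinearMap.comp_apply, LinearMap.rTensor_comp_lTensor,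
      LinearMap.lTensor_comp_rTensor]

end Both

/-- The base field acts through the quotient (declared last, so that it is found first). -/
instance instModuleBase' : Module k (BalTensor k A M N) := instModuleBase k A M N

end BalTensor

end BalTensor

/-! ### Gradings -/

section Gradings

variable (k : Type u) [Field k]

/-- A locally finite `ℕ`-grading of the `k`-algebra `A`. -/
structure IsLocallyFiniteGrading {A : Type*} [Ring A] [Algebra k A]
    (𝒜 : ℕ → Submodule k A) : Prop where
  one_mem : (1 : A) ∈ 𝒜 0
  mul_mem : ∀ ⦃i j : ℕ⦄ ⦃a b : A⦄, a ∈ 𝒜 i → b ∈ 𝒜 j → a * b ∈ 𝒜 (i + j)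
  isInternal : DirectSum.IsInternal 𝒜
  finite : ∀ i, FiniteDimensional k ↥(𝒜 i)

variable {k}

/-- A `ℤ`-graded `(D, A)`-bimodule over `ℕ`-graded algebras `D` and `A`. -/
structure IsGradedBimodule {D A X : Type*} [Ring D] [Algebra k D] [Ring A] [Algebra k A]
    [AddCommGroup X] [Module k X] [Module D X] [Module Aᵐᵒᵖ X]
    (𝒟 : ℕ → Submodule k D) (𝒜 : ℕ → Submodule k A) (𝒳 : ℤ → Submodule k X) : Prop where
  isInternal : DirectSum.IsInternal 𝒳
  left_smul_mem : ∀ ⦃i : ℕ⦄ ⦃j : ℤ⦄ ⦃a : D⦄ ⦃x : X⦄,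
    a ∈ 𝒟 i → x ∈ 𝒳 j → a • x ∈ 𝒳 ((i : ℤ) + j)
  right_smul_mem : ∀ ⦃i : ℕ⦄ ⦃j : ℤ⦄ ⦃a : A⦄ ⦃x : X⦄,
    a ∈ 𝒜 i → x ∈ 𝒳 j → op a • x ∈ 𝒳 (j + (i : ℤ))

/-- An `ℕ`-indexed family viewed as a `ℤ`-indexed one, zero in negative degrees. -/
def intGrading {X : Type*} [AddCommGroup X] [Module k X] (𝒳 : ℕ → Submodule k X) :
    ℤ → Submodule k X
  | Int.ofNat n => 𝒳 n
  | Int.negSucc _ => ⊥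

/-- The grading of `M ⊗_A N` induced by gradings of `M` and `N`. -/
def tensorGrading {A M N : Type*} [Ring A] [Algebra k A]
    [AddCommGroup M] [Module k M] [Module Aᵐᵒᵖ M] [IsScalarTower k Aᵐᵒᵖ M]
    [AddCommGroup N] [Module k N] [Module A N] [IsScalarTower k A N]
    (ℳ : ℤ → Submodule k M) (𝒩 : ℤ → Submodule k N) :
    ℤ → Submodule k (BalTensor k A M N) := fun i =>
  Submodule.span k {t | ∃ p q : ℤ, p + q = i ∧ ∃ m ∈ ℳ p, ∃ n ∈ 𝒩 q, t = BalTensor.tmul k A m n}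

end Gradings

/-! ### Isomorphism up to modules of small dimension -/

section SIsomorphic

variable (k : Type u) [Field k]

/-- A map of right `A`-modules whose kernel and cokernel have `GK`-dimension at most `s`. -/
def IsSIso (A : Type*) [Ring A] [Algebra k A] (s : EReal) {X P : Type*}
    [AddCommGroup X] [Module k X] [Module Aᵐᵒᵖ X] [IsScalarTower k Aᵐᵒᵖ X]
    [AddCommGroup P] [Module k P] [Module Aᵐᵒᵖ P] [IsScalarTower k Aᵐᵒᵖ P]
    (f : X →ₗ[Aᵐᵒᵖ] P) : Prop :=
  gkDim k Aᵐᵒᵖ ↥(LinearMap.ker f) ≤ s ∧ gkDim k Aᵐᵒᵖ (P ⧸ LinearMap.range f) ≤ s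

/-- The `(D, A)`-bimodules `X` and `Y` are `s`-isomorphic. -/
def SIsomorphic (D A : Type*) [Ring D] [Algebra k D] [Ring A] [Algebra k A] (s : EReal)
    (X Y : Type v)
    [AddCommGroup X] [Module k X] [Module D X] [Module Aᵐᵒᵖ X]
    [IsScalarTower k D X] [IsScalarTower k Aᵐᵒᵖ X] [SMulCommClass D Aᵐᵒᵖ X]
    [AddCommGroup Y] [Module k Y] [Module D Y] [Module Aᵐᵒᵖ Y]
    [IsScalarTower k D Y] [IsScalarTower k Aᵐᵒᵖ Y] [SMulCommClass D Aᵐᵒᵖ Y] : Prop :=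
  ∃ (P : Type v) (_ : AddCommGroup P) (_ : Module k P) (_ : Module D P) (_ : Module Aᵐᵒᵖ P)
    (_ : IsScalarTower k D P) (_ : IsScalarTower k Aᵐᵒᵖ P) (_ : SMulCommClass D Aᵐᵒᵖ P)
    (f : X →ₗ[Aᵐᵒᵖ] P) (g : Y →ₗ[Aᵐᵒᵖ] P),
    (∀ (b : D) (x : X), f (b • x) = b • f x) ∧ (∀ (b : D) (y : Y), g (b • y) = b • g y) ∧
    IsSIso k A s f ∧ IsSIso k A s g

/-- The graded `(D, A)`-bimodules `X` and `Y` are `s`-isomorphic as graded bimodules: the third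
bimodule is graded and the maps preserve degrees. -/
def GradedSIsomorphic {k : Type u} [Field k]
    {D A : Type*} [Ring D] [Algebra k D] [Ring A] [Algebra k A]
    (𝒟 : ℕ → Submodule k D) (𝒜 : ℕ → Submodule k A) (s : EReal) {X Y : Type v}
    [AddCommGroup X] [Module k X] [Module D X] [Module Aᵐᵒᵖ X]
    [IsScalarTower k D X] [IsScalarTower k Aᵐᵒᵖ X] [SMulCommClass D Aᵐᵒᵖ X]
    [AddCommGroup Y] [Module k Y] [Module D Y] [Module Aᵐᵒᵖ Y]
    [IsScalarTower k D Y] [IsScalarTower k Aᵐᵒᵖ Y] [SMulCommClass D Aᵐᵒᵖ Y]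
    (𝒳 : ℤ → Submodule k X) (𝒴 : ℤ → Submodule k Y) : Prop :=
  ∃ (P : Type v) (_ : AddCommGroup P) (_ : Module k P) (_ : Module D P) (_ : Module Aᵐᵒᵖ P)
    (_ : IsScalarTower k D P) (_ : IsScalarTower k Aᵐᵒᵖ P) (_ : SMulCommClass D Aᵐᵒᵖ P)
    (𝒬 : ℤ → Submodule k P) (f : X →ₗ[Aᵐᵒᵖ] P) (g : Y →ₗ[Aᵐᵒᵖ] P),
    IsGradedBimodule 𝒟 𝒜 𝒬 ∧
    (∀ (b : D) (x : X), f (b • x) = b • f x) ∧ (∀ (b : D) (y : Y), g (b • y) = b • g y) ∧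
    (∀ i, ∀ x ∈ 𝒳 i, f x ∈ 𝒬 i) ∧ (∀ i, ∀ y ∈ 𝒴 i, g y ∈ 𝒬 i) ∧
    IsSIso k A s f ∧ IsSIso k A s g

end SIsomorphic

/-! ### Noncommutative quasi-resolutions -/

section QuasiResolution

variable (k : Type u) [Field k] (B A M N : Type v)
  [Ring B] [Algebra k B] [Ring A] [Algebra k A]
  [AddCommGroup M] [Module k M] [Module B M] [Module Aᵐᵒᵖ M]
  [IsScalarTower k B M] [IsScalarTower k Aᵐᵒᵖ M] [SMulCommClass B Aᵐᵒᵖ M]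
  [AddCommGroup N] [Module k N] [Module A N] [Module Bᵐᵒᵖ N]
  [IsScalarTower k A N] [IsScalarTower k Bᵐᵒᵖ N] [SMulCommClass A Bᵐᵒᵖ N]

/-- The conditions on the algebras and on the bimodules `M` and `N`, other than the two
isomorphisms, in the definition of a quasi-resolution in dimension `d`. -/
structure QuasiResolutionData (d : ℕ) : Prop where
  two_le : 2 ≤ d
  left_noetherian_base : IsNoetherianRing A
  right_noetherian_base : IsNoetherianRing Aᵐᵒᵖ
  gkDim_base : gkDim k Aᵐᵒᵖ A = (d : EReal)
  left_noetherian : IsNoetherianRing B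
  right_noetherian : IsNoetherianRing Bᵐᵒᵖ
  auslanderRegular : IsAuslanderRegular B
  cohenMacaulay : IsCohenMacaulay B k d
  finite_left_M : Module.Finite B M
  finite_right_M : Module.Finite Aᵐᵒᵖ M
  finite_left_N : Module.Finite A N
  finite_right_N : Module.Finite Bᵐᵒᵖ N

/-- `(B, M, N)` is a noncommutative quasi-resolution of the (ungraded) algebra `A` with
`GK(A) = d`. -/
structure IsNQR (d : ℕ) : Prop extends QuasiResolutionData k B A M N d where
  isoB : SIsomorphic k B B (((d : ℝ) - 2 : ℝ) : EReal) (BalTensor k A M N) B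
  isoA : SIsomorphic k A A (((d : ℝ) - 2 : ℝ) : EReal) (BalTensor k B N M) A

variable {k B A M N}

/-- `(B, M, N)` is a noncommutative quasi-resolution of the locally finite `ℕ`-graded algebra `A`
with `GK(A) = d`, in the graded sense. -/
structure IsGradedNQR (ℬ : ℕ → Submodule k B) (𝒜 : ℕ → Submodule k A)
    (ℳ : ℤ → Submodule k M) (𝒩 : ℤ → Submodule k N) (d : ℕ) : Prop
    extends QuasiResolutionData k B A M N d where
  grading_base : IsLocallyFiniteGrading k 𝒜
  grading : IsLocallyFiniteGrading k ℬ
  graded_M : IsGradedBimodule ℬ 𝒜 ℳ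
  graded_N : IsGradedBimodule 𝒜 ℬ 𝒩
  isoB : GradedSIsomorphic ℬ ℬ (((d : ℝ) - 2 : ℝ) : EReal)
    (tensorGrading (A := A) ℳ 𝒩) (intGrading ℬ)
  isoA : GradedSIsomorphic 𝒜 𝒜 (((d : ℝ) - 2 : ℝ) : EReal)
    (tensorGrading (A := B) 𝒩 ℳ) (intGrading 𝒜)

end QuasiResolution

/-! ### The Peirce pieces `eBe`, `Be`, `eB` and the ideal `BeB` -/

section Peirce

variable {k : Type u} [Field k] {B : Type v} [Ring B] [Algebra k B]

/-- The left ideal `Be`. -/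
abbrev peirceLeft (e : B) : Submodule B B := Submodule.span B {e}

/-- The right ideal `eB`. -/
abbrev peirceRight (e : B) : Submodule Bᵐᵒᵖ B := Submodule.span Bᵐᵒᵖ {e}

/-- The two-sided ideal `BeB`, the right ideal generated by all `x e`. -/
def idealBeB (e : B) : Submodule Bᵐᵒᵖ B := Submodule.span Bᵐᵒᵖ (Set.range fun x : B => x * e)

theorem mem_peirceLeft {e : B} (he : IsIdempotentElem e) {x : B} :
    x ∈ peirceLeft e ↔ x * e = x := by
  rw [Submodule.mem_span_singleton]
  constructor
  · rintro ⟨b, rfl⟩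
    simp [mul_assoc, he.eq]
  · intro h
    exact ⟨x, h⟩

theorem mem_peirceRight {e : B} (he : IsIdempotentElem e) {x : B} :
    x ∈ peirceRight e ↔ e * x = x := by
  rw [Submodule.mem_span_singleton]
  constructor
  · rintro ⟨b, rfl⟩
    simp [← mul_assoc, he.eq]
  · intro h
    exact ⟨op x, h⟩

variable {e : B} (he : IsIdempotentElem e)

namespace Corner

theorem left_eq (a : he.Corner) : e * a.1 = a.1 := ((Subsemigroup.mem_corner_iff he).1 a.2).1

theorem right_eq (a : he.Corner) : a.1 * e = a.1 := ((Subsemigroup.mem_corner_iff he).1 a.2).2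

instance : Module k he.Corner where
  smul c a := ⟨c • a.1, (Subsemigroup.mem_corner_iff he).2
    ⟨by rw [mul_smul_comm, left_eq], by rw [smul_mul_assoc, right_eq]⟩⟩
  one_smul a := Subtype.ext (one_smul k a.1)
  mul_smul c c' a := Subtype.ext (mul_smul c c' a.1)
  smul_zero c := Subtype.ext (smul_zero (A := B) c)
  smul_add c a a' := Subtype.ext (smul_add c a.1 a'.1)
  add_smul c c' a := Subtype.ext (add_smul c c' a.1)
  zero_smul a := Subtype.ext (zero_smul k a.1)

/-- The `k`-algebra structure of `eBe`. -/
instance : Algebra k he.Corner :=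
  Algebra.ofModule (fun c a b => Subtype.ext (smul_mul_assoc c a.1 b.1))
    (fun c a b => Subtype.ext (mul_smul_comm c a.1 b.1))

/-- The inclusion of `eBe` in `B`. -/
def incl : he.Corner →ₗ[k] B where
  toFun a := a.1
  map_add' _ _ := rfl
  map_smul' _ _ := rfl

end Corner

/-- `Be` is a right `eBe`-module by multiplication. -/
instance : Module he.Cornerᵐᵒᵖ ↥(peirceLeft e) where
  smul a x := ⟨x.1 * (unop a).1, (mem_peirceLeft he).2 (by rw [mul_assoc, Corner.right_eq])⟩
  one_smul x := Subtype.ext ((mem_peirceLeft he).1 x.2)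
  mul_smul a b x := Subtype.ext (mul_assoc x.1 (unop b).1 (unop a).1).symm
  smul_zero a := Subtype.ext (zero_mul (unop a).1)
  smul_add a x y := Subtype.ext (add_mul x.1 y.1 (unop a).1)
  add_smul a b x := Subtype.ext (mul_add x.1 (unop a).1 (unop b).1)
  zero_smul x := Subtype.ext (mul_zero x.1)

instance : IsScalarTower k he.Cornerᵐᵒᵖ ↥(peirceLeft e) where
  smul_assoc c a x := Subtype.ext (mul_smul_comm c x.1 (unop a).1)

instance : SMulCommClass B he.Cornerᵐᵒᵖ ↥(peirceLeft e) where
  smul_comm b a x := Subtype.ext (mul_assoc b x.1 (unop a).1).symm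

/-- `eB` is a left `eBe`-module by multiplication. -/
instance : Module he.Corner ↥(peirceRight e) where
  smul a x := ⟨a.1 * x.1, (mem_peirceRight he).2 (by rw [← mul_assoc, Corner.left_eq])⟩
  one_smul x := Subtype.ext ((mem_peirceRight he).1 x.2)
  mul_smul a b x := Subtype.ext (mul_assoc a.1 b.1 x.1)
  smul_zero a := Subtype.ext (mul_zero a.1)
  smul_add a x y := Subtype.ext (mul_add a.1 x.1 y.1)
  add_smul a b x := Subtype.ext (add_mul a.1 b.1 x.1)
  zero_smul x := Subtype.ext (zero_mul x.1)

instance : IsScalarTower k he.Corner ↥(peirceRight e) where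
  smul_assoc c a x := Subtype.ext (smul_mul_assoc c a.1 x.1)

instance : SMulCommClass he.Corner Bᵐᵒᵖ ↥(peirceRight e) where
  smul_comm a b x := Subtype.ext (mul_assoc a.1 x.1 (unop b)).symm

/-- The grading of `eBe` induced from `B`. -/
def cornerGrading (ℬ : ℕ → Submodule k B) (i : ℕ) : Submodule k he.Corner :=
  (ℬ i).comap (Corner.incl he)

/-- The grading of `Be` induced from `B`. -/
def leftGrading (ℬ : ℕ → Submodule k B) (e : B) (i : ℤ) : Submodule k ↥(peirceLeft e) :=
  (intGrading ℬ i).comap ((peirceLeft e).subtype.restrictScalars k)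

/-- The grading of `eB` induced from `B`. -/
def rightGrading (ℬ : ℕ → Submodule k B) (e : B) (i : ℤ) : Submodule k ↥(peirceRight e) :=
  (intGrading ℬ i).comap ((peirceRight e).subtype.restrictScalars k)

end Peirce

end QuasiRes

namespace QuasiRes

set_option linter.unusedSectionVars false

universe u v

/-! ### Growth exponents and bounded factors. -/

section Growth

open Filter Topology

/-! Both comparisons come from multiplication, with target `B` or `eBe` itself and the identity as
the second leg.

The map `eB ⊗_B Be → eBe` is bijective: `x ⊗ y = e ⊗ xy`, so `a ↦ e ⊗ a` is inverse to it
(`mulToCorner_bijective`).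

The map `μ : Be ⊗_{eBe} eB → B` has image `BeB`, so its cokernel `B/BeB` is small by hypothesis. For
`x ∈ Be` and `y ∈ eB`, moving elements of `eBe` across the tensor sign gives `t · (xy) = μ(t)x ⊗ y`
(`mul_smul_eq_tmul`). So `BeB` kills the kernel on the right. The tensor product is finitely
generated over the right noetherian ring `B`, hence so is the kernel, which is then a quotient of
some `(B/BeB)^l` and is small as well (`isSIso_mulToRing`).

It remains to see that `eBe` is noetherian with `GK(eBe) = d`. Noetherianity holds because a left
ideal `I` of `eBe` is recovered from `BI` as `e(BI)e`. The bound `GK(eBe) ≤ d` comes from the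
inclusion in `B`. Conversely `e ≠ 0`, so `Be` is a nonzero left ideal; it has grade 0, and the CM
property gives it dimension `d` over `B`. As `Be` is a bimodule that is finite over `eBe`, this
dimension is at most `GK(eBe)` (`gkDim_le_of_finite_bimodule`).

If `e` has degree 0, the maps `b ↦ be`, `eb`, `ebe` are homogeneous projections, so all gradings
restrict and multiplication preserves degrees. -/

theorem limsup_log_div_log_le {f g : ℕ → ℕ} (c : ℕ) (h : ∀ n, f n ≤ c * g n) :
    limsup (fun n : ℕ => ENNReal.log (f n : ℝ≥0∞) / ((Real.log n : ℝ) : EReal)) atTop ≤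
      limsup (fun n : ℕ => ENNReal.log (g n : ℝ≥0∞) / ((Real.log n : ℝ) : EReal)) atTop := by
  -- The factor contributes `log (c + 1) / log n`, which tends to 0. Using `c + 1` keeps the
  -- logarithm finite when `c = 0`.
  have hlim : Tendsto (fun n : ℕ => ((Real.log (c + 1 : ℕ) / Real.log n : ℝ) : EReal)) atTop
      (𝓝 0) := by
    have h0 : Tendsto (fun n : ℕ => Real.log (c + 1 : ℕ) / Real.log n) atTop (𝓝 0) :=
      tendsto_const_nhds.div_atTop (Real.tendsto_log_atTop.comp tendsto_natCast_atTop_atTop)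
    exact_mod_cast (continuous_coe_real_ereal.tendsto 0).comp h0
  have hsup := hlim.limsup_eq
  have hle : ∀ n : ℕ, ENNReal.log (f n : ℝ≥0∞) / ((Real.log n : ℝ) : EReal) ≤
      ((Real.log (c + 1 : ℕ) / Real.log n : ℝ) : EReal) +
        ENNReal.log (g n : ℝ≥0∞) / ((Real.log n : ℝ) : EReal) := by
    intro n
    -- Only nonnegativity of `log n` is needed, so `n = 0, 1`, where the denominator is 0, are not
    -- exceptional.
    have hn : (0 : EReal) ≤ ((Real.log n : ℝ) : EReal) := by
      exact_mod_cast Real.log_natCast_nonneg n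
    have h1 : (f n : ℝ≥0∞) ≤ ((c + 1 : ℕ) : ℝ≥0∞) * (g n : ℝ≥0∞) := by
      exact_mod_cast (h n).trans (Nat.mul_le_mul_right _ c.le_succ)
    have h2 : ENNReal.log ((c + 1 : ℕ) : ℝ≥0∞) = ((Real.log (c + 1 : ℕ) : ℝ) : EReal) := by
      rw [ENNReal.log_pos_real (by simp) (by exact ENNReal.natCast_ne_top _),
        ENNReal.toReal_natCast]
    refine (EReal.div_le_div_right_of_nonneg hn (ENNReal.log_le_log h1)).trans ?_
    rw [ENNReal.log_mul_add, EReal.add_div_of_nonneg_right hn, h2, EReal.coe_div]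
  refine (limsup_le_limsup (Eventually.of_forall hle)).trans ?_
  refine (EReal.limsup_add_le (Or.inl ?_) (Or.inl ?_)).trans ?_ <;> rw [hsup] <;> simp

end Growth

/-! ### Comparison of Gelfand–Kirillov dimensions. -/

section GKDimension

variable {k : Type*} [Field k]
variable {R : Type*} [Ring R] [Algebra k R] {S : Type*} [Ring S] [Algebra k S]
variable {M : Type*} [AddCommGroup M] [Module k M] [Module R M] [IsScalarTower k R M]
variable {N : Type*} [AddCommGroup N] [Module k N] [Module S N] [IsScalarTower k S N]

/-- The product is the image of a bilinear map. Finiteness is needed because `finrank` is 0 on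
infinite-dimensional spaces and so is not monotone in general. -/
theorem fg_smul {V : Submodule k R} {F : Submodule k M} (hV : V.FG) (hF : F.FG) : (V • F).FG := by
  have : V • F = Submodule.map₂ (LinearMap.mk₂ k (fun (r : R) (m : M) => r • m)
      add_smul smul_assoc smul_add fun c r m => smul_algebra_smul_comm c r m) V F := by
    refine le_antisymm (Submodule.smul_le.2 fun r hr m hm => ?_)
      (Submodule.map₂_le.2 fun r hr m hm => Submodule.smul_mem_smul hr hm)
    exact Submodule.apply_mem_map₂ _ hr hm
  rw [this]
  exact hV.map₂ _ hF

theorem submodule_mul_smul (V W : Submodule k R) (F : Submodule k M) :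
    (V * W) • F = V • W • F := Submodule.smul_assoc V W F

theorem pow_succ_smul (V : Submodule k R) (F : Submodule k M) (n : ℕ) :
    V ^ (n + 1) • F = V • V ^ n • F := by
  rw [pow_succ', submodule_mul_smul]

/-- A comparison principle for growth. -/
theorem gkDim_le_of_finrank_le
    (h : ∀ (V : Submodule k R) (F : Submodule k M), 1 ∈ V → V.FG → F.FG →
      ∃ (W : Submodule k S) (G : Submodule k N) (c : ℕ), 1 ∈ W ∧ W.FG ∧ G.FG ∧
        ∀ n, Module.finrank k ↥(V ^ n • F) ≤ c * Module.finrank k ↥(W ^ n • G)) :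
    gkDim k R M ≤ gkDim k S N := by
  refine iSup_le fun V => iSup_le fun F => iSup_le fun h1 => iSup_le fun hV => iSup_le fun hF => ?_
  obtain ⟨W, G, c, hW1, hW, hG, hle⟩ := h V F h1 hV hF
  refine (limsup_log_div_log_le c hle).trans ?_
  unfold gkDim
  exact le_iSup_of_le W <| le_iSup_of_le G <| le_iSup_of_le hW1 <| le_iSup_of_le hW <|
    le_iSup_of_le hG le_rfl

/-- The range of a `k`-linear map from a power of a finite-dimensional space. -/
theorem finrank_le_of_le_range_pi {ι X Y : Type*} [Fintype ι] [AddCommGroup X] [Module k X]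
    [AddCommGroup Y] [Module k Y] {P : Submodule k X} (hP : P.FG) (φ : (ι → P) →ₗ[k] Y)
    {Q : Submodule k Y} (hQ : Q ≤ LinearMap.range φ) :
    Module.finrank k Q ≤ Fintype.card ι * Module.finrank k P := by
  have : Module.Finite k P := Module.Finite.iff_fg.2 hP
  calc Module.finrank k Q ≤ Module.finrank k (LinearMap.range φ) := Submodule.finrank_mono hQ
    _ ≤ Module.finrank k (ι → P) := LinearMap.finrank_range_le φ
    _ = _ := by simp [Module.finrank_pi_fintype]

/-- Growth does not increase along an injection that is semilinear for a multiplicative map of the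
rings. -/
theorem gkDim_le_of_injective (θ : R →ₗ[k] S) (φ : M →ₗ[k] N) (hφ : Function.Injective φ)
    (hθ : ∀ r m, φ (r • m) = θ r • φ m) : gkDim k R M ≤ gkDim k S N := by
  -- `θ` need not be unital (the inclusion of `eBe` sends 1 to `e`), so 1 is adjoined to the image
  -- of `V`.
  refine gkDim_le_of_finrank_le fun V F _ hV hF => ⟨V.map θ ⊔ Submodule.span k {1}, F.map φ, 1,
    Submodule.mem_sup_right (Submodule.mem_span_singleton_self 1),
    (hV.map θ).sup (Submodule.fg_span_singleton 1), hF.map φ, fun n => ?_⟩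
  have key : ∀ n : ℕ, (V ^ n • F).map φ ≤ (V.map θ ⊔ Submodule.span k {1}) ^ n • F.map φ := by
    intro n
    induction n with
    | zero => rw [pow_zero, pow_zero, Submodule.one_smul, Submodule.one_smul]
    | succ n ih =>
      rw [pow_succ_smul, pow_succ_smul, Submodule.map_le_iff_le_comap]
      refine Submodule.smul_le.2 fun r hr m hm => ?_
      rw [Submodule.mem_comap, hθ]
      exact Submodule.smul_mem_smul (Submodule.mem_sup_left (Submodule.mem_map_of_mem hr))
        (ih (Submodule.mem_map_of_mem hm))
  have : Module.Finite k ↥((V.map θ ⊔ Submodule.span k {1}) ^ n • F.map φ) :=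
    Module.Finite.iff_fg.2 (fg_smul
      (((hV.map θ).sup (Submodule.fg_span_singleton 1)).pow n) (hF.map φ))
  rw [one_mul, (Submodule.equivMapOfInjective φ hφ _).finrank_eq]
  exact Submodule.finrank_mono (key n)

/-- If finitely many `R`-linear maps `X → M` are jointly surjective, then `GK(M) ≤ GK(X)`. -/
theorem gkDim_le_of_jointly_surjective {ι X : Type*} [Fintype ι] [AddCommGroup X] [Module k X]
    [Module R X] [IsScalarTower k R X] (φ : ι → X →ₗ[R] M)
    (hφ : ∀ m, ∃ x : ι → X, m = ∑ i, φ i (x i)) : gkDim k R M ≤ gkDim k R X := by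
  choose x hx using hφ
  refine gkDim_le_of_finrank_le fun V F h1 hV hF => ?_
  obtain ⟨s, hs, rfl⟩ := Submodule.fg_def.1 hF
  -- The chosen preimages are not linear in `m`, so only those of a finite spanning set of `F` are
  -- collected. By linearity over `R`, `V ^ n • F` then lies in the image of the `ι`-fold power of
  -- `V ^ n • span T`.
  let T : Set X := ⋃ m ∈ s, Set.range (x m)
  have hT : T.Finite := hs.biUnion fun m _ => Set.finite_range _
  refine ⟨V, Submodule.span k T, Fintype.card ι, h1, hV, Submodule.fg_span hT, fun n => ?_⟩
  let Φ (P : Submodule k X) : (ι → P) →ₗ[k] M :=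
    ∑ i, ((φ i).restrictScalars k ∘ₗ P.subtype) ∘ₗ LinearMap.proj i
  have hΦ (P : Submodule k X) (y : ι → P) : Φ P y = ∑ i, φ i (y i) := by
    simp [Φ, LinearMap.sum_apply]
  refine finrank_le_of_le_range_pi (fg_smul (hV.pow n) (Submodule.fg_span hT)) (Φ _) ?_
  induction n with
  | zero =>
    rw [pow_zero, Submodule.one_smul, Submodule.span_le]
    intro m hm
    refine ⟨fun i => ⟨x m i, ?_⟩, ?_⟩
    · rw [Submodule.one_smul]
      exact Submodule.subset_span (Set.mem_biUnion hm ⟨i, rfl⟩)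
    · rw [hΦ]
      exact (hx m).symm
  | succ n ih =>
    rw [pow_succ_smul]
    refine Submodule.smul_le.2 fun r hr m hm => ?_
    obtain ⟨y, rfl⟩ := ih hm
    refine ⟨fun i => ⟨r • (y i).1, ?_⟩, ?_⟩
    · rw [pow_succ_smul]
      exact Submodule.smul_mem_smul hr (y i).2
    · rw [hΦ, hΦ, Finset.smul_sum]
      simp

/-- A bimodule that is finitely generated over `S` has `GK`-dimension over `R` at most `GK(S)`. -/
theorem gkDim_le_of_finite_bimodule [Module S M] [IsScalarTower k S M] [SMulCommClass R S M]
    [Module.Finite S M] : gkDim k R M ≤ gkDim k S S := by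
  obtain ⟨l, x, hx⟩ := Module.Finite.exists_fin (R := S) (M := M)
  have hc : ∀ m : M, ∃ c : Fin l → S, m = ∑ i, c i • x i := fun m => by
    have hm : m ∈ Submodule.span S (Set.range x) := hx ▸ Submodule.mem_top
    obtain ⟨c, hc⟩ := (Submodule.mem_span_range_iff_exists_fun S).1 hm
    exact ⟨c, hc.symm⟩
  choose c hc using hc
  let X : Submodule k M := Submodule.span k (Set.range x)
  have hX : X.FG := Submodule.fg_span (Set.finite_range x)
  have bound (F : Submodule k M) (hF : F.FG) :
      ∃ W : Submodule k S, 1 ∈ W ∧ W.FG ∧ F ≤ W • X := by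
    obtain ⟨s, hs, rfl⟩ := Submodule.fg_def.1 hF
    refine ⟨Submodule.span k (insert 1 (⋃ m ∈ s, Set.range (c m))),
      Submodule.subset_span (Set.mem_insert _ _),
      Submodule.fg_span ((hs.biUnion fun m _ => Set.finite_range _).insert _),
      Submodule.span_le.2 fun m hm => ?_⟩
    rw [hc m]
    exact Submodule.sum_mem _ fun i _ => Submodule.smul_mem_smul
      (Submodule.subset_span (Set.mem_insert_of_mem _ (Set.mem_biUnion hm ⟨i, rfl⟩)))
      (Submodule.subset_span ⟨i, rfl⟩)
  refine gkDim_le_of_finrank_le fun V F _ hV hF => ?_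
  -- One `W` absorbs both `F` and `V • X` into `W • X`. Since the two actions commute, each further
  -- factor `V` costs one factor `W`, so `V ^ n • F ≤ W ^ (n + 1) • X`.
  obtain ⟨W, hW1, hW, hle⟩ := bound (F ⊔ V • X) (hF.sup (fg_smul hV hX))
  have hFW : F ≤ W • X := le_sup_left.trans hle
  have hVW : V • X ≤ W • X := le_sup_right.trans hle
  -- The second `W` is the subspace of the module `S`, accounting for the extra power; the constant
  -- counts the generators `x i`.
  refine ⟨W, W, Fintype.card (Fin l), hW1, hW, hW, fun n => ?_⟩
  have key : V ^ n • F ≤ (W ^ n • W) • X := by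
    induction n with
    | zero => rwa [pow_zero, pow_zero, Submodule.one_smul, Submodule.one_smul]
    | succ n ih =>
      rw [pow_succ_smul]
      refine Submodule.smul_le.2 fun r hr m hm => ?_
      refine Submodule.smul_induction_on (ih hm) (fun t ht y hy => ?_) fun a b ha hb => ?_
      · have h1 : r • t • y = t • r • y := smul_comm r t y
        have h2 : t • r • y ∈ (W ^ n • W) • W • X :=
          Submodule.smul_mem_smul ht (hVW (Submodule.smul_mem_smul hr hy))
        rwa [h1, Submodule.smul_assoc, pow_succ, submodule_mul_smul, ← Submodule.smul_assoc (W ^ n)]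
      · rw [smul_add]
        exact add_mem ha hb
  let P : Submodule k S := W ^ n • W
  let Φ : (Fin l → P) →ₗ[k] M :=
    ∑ i, (((LinearMap.toSpanSingleton S M (x i)).restrictScalars k) ∘ₗ P.subtype) ∘ₗ
      LinearMap.proj i
  have hΦ (y : Fin l → P) : Φ y = ∑ i, (y i).1 • x i := by
    simp [Φ, LinearMap.sum_apply]
  refine finrank_le_of_le_range_pi (fg_smul (hW.pow n) hW) Φ (key.trans ?_)
  refine Submodule.smul_le.2 fun t ht y hy => ?_
  induction hy using Submodule.span_induction with
  | mem y hy =>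
    obtain ⟨i, rfl⟩ := hy
    refine ⟨Pi.single i ⟨t, ht⟩, ?_⟩
    rw [hΦ, Finset.sum_eq_single i]
    · simp
    · intro j _ hj
      simp [Pi.single_eq_of_ne hj]
    · simp
  | zero => simp
  | add a b _ _ ha hb => rw [smul_add]; exact add_mem ha hb
  | smul a y _ hy => rw [smul_algebra_smul_comm]; exact Submodule.smul_mem _ a hy

theorem gkDim_of_subsingleton [Subsingleton M] : gkDim k R M = ⊥ := by
  refine le_bot_iff.1 (iSup_le fun V => iSup_le fun F => iSup_le fun _ => iSup_le fun _ =>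
    iSup_le fun _ => ?_)
  refine (Filter.limsup_congr (v := fun _ => (⊥ : EReal)) ?_).le.trans
    (Filter.limsup_const _).le
  -- For `n ≤ 1` the quotient is `⊥ / 0 = 0`, so the sequence equals `⊥` only from `n = 2` on.
  filter_upwards [Filter.eventually_gt_atTop 1] with n hn
  have : (0 : ℝ) < Real.log n := Real.log_pos (by exact_mod_cast hn)
  rw [Module.finrank_zero_of_subsingleton, Nat.cast_zero, ENNReal.log_zero]
  exact EReal.bot_div_of_pos_ne_top (by exact_mod_cast this) (EReal.coe_ne_top _)

end GKDimension

/-! ### Grade zero and the Cohen–Macaulay property. -/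

section Grade

open CategoryTheory CategoryTheory.Abelian

/-- `Ext⁰` is `Hom`, so `f` is itself a nonzero class in degree 0. -/
theorem gradeNumber_eq_zero {R : Type v} [Ring R] {M : Type v} [AddCommGroup M] [Module R M]
    (f : M →ₗ[R] R) (hf : f ≠ 0) : gradeNumber R M = 0 := by
  have : Nontrivial (ExtRing R M 0) := by
    refine ⟨Ext.mk₀ (ModuleCat.ofHom f), 0, fun h => hf ?_⟩
    have := congrArg ModuleCat.Hom.hom ((Ext.mk₀_eq_zero_iff _).1 h)
    simpa using this
  exact le_antisymm (iInf₂_le_of_le 0 this le_rfl) bot_le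

/-- A nonzero finitely generated left ideal of a Cohen-Macaulay algebra has full dimension. -/
theorem LeftCM.gkDim_leftIdeal {k : Type u} [Field k] {R : Type v} [Ring R] [Algebra k R] {d : ℕ}
    (h : LeftCM R k d) (I : Submodule R R) [Module.Finite R I] (hI : I ≠ ⊥) :
    gkDim k R I = d := by
  have : Nontrivial I := Submodule.nontrivial_iff_ne_bot.2 hI
  -- The inclusion of `I` in `R` is a nonzero homomorphism, so the CM equality leaves all of `d` to
  -- the dimension.
  have h0 : gradeNumber R I = 0 := gradeNumber_eq_zero I.subtype fun h =>
    hI (by rw [← I.range_subtype, h, LinearMap.range_zero])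
  simpa [h0] using h I

end Grade

/-! ### Universal property of the balanced tensor product. -/

namespace BalTensor

section Lift

variable {k : Type*} [Field k] {A : Type*} [Ring A] [Algebra k A]
  {M : Type*} [AddCommGroup M] [Module k M] [Module Aᵐᵒᵖ M] [IsScalarTower k Aᵐᵒᵖ M]
  {N : Type*} [AddCommGroup N] [Module k N] [Module A N] [IsScalarTower k A N]

@[elab_as_elim]
theorem induction_on {p : BalTensor k A M N → Prop} (t : BalTensor k A M N)
    (tmul : ∀ m n, p (tmul k A m n)) (add : ∀ x y, p x → p y → p (x + y)) : p t := by
  obtain ⟨t, rfl⟩ := mk_surjective k A M N t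
  induction t using TensorProduct.induction_on with
  | zero => simpa [BalTensor.tmul] using tmul 0 0
  | tmul m n => exact tmul m n
  | add x y hx hy => rw [map_add]; exact add _ _ hx hy

theorem tmul_add (m : M) (n n' : N) : tmul k A m (n + n') = tmul k A m n + tmul k A m n' := by
  simp [tmul, TensorProduct.tmul_add]

theorem add_tmul (m m' : M) (n : N) : tmul k A (m + m') n = tmul k A m n + tmul k A m' n := by
  simp [tmul, TensorProduct.add_tmul]

theorem zero_tmul (n : N) : tmul k A (0 : M) n = 0 := by
  simp [tmul]

theorem smul_tmul (m : M) (a : A) (n : N) : tmul k A (op a • m) n = tmul k A m (a • n) := by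
  rw [← sub_eq_zero]
  change mk k A M N _ - mk k A M N _ = 0
  rw [← map_sub]
  exact (Submodule.Quotient.mk_eq_zero _).2 (Submodule.subset_span ⟨m, a, n, rfl⟩)

variable {P : Type*} [AddCommGroup P] [Module k P]

/-- A balanced bilinear map factors through the tensor product over `A`. -/
def lift (β : M →ₗ[k] N →ₗ[k] P) (hβ : ∀ m (a : A) n, β (op a • m) n = β m (a • n)) :
    BalTensor k A M N →ₗ[k] P :=
  (balancedRel k A M N).liftQ (TensorProduct.lift β) <| by
    refine Submodule.span_le.2 ?_
    rintro _ ⟨m, a, n, rfl⟩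
    simp [hβ]

variable {D : Type*} [Ring D] [Algebra k D] [Module Dᵐᵒᵖ N] [IsScalarTower k Dᵐᵒᵖ N]
  [SMulCommClass A Dᵐᵒᵖ N] [Module Dᵐᵒᵖ P]

/-- The factorization of a balanced bilinear map that is right linear in the second variable. -/
def liftRight (β : M →ₗ[k] N →ₗ[k] P) (hβ : ∀ m (a : A) n, β (op a • m) n = β m (a • n))
    (hD : ∀ m n (c : Dᵐᵒᵖ), β m (c • n) = c • β m n) : BalTensor k A M N →ₗ[Dᵐᵒᵖ] P where
  toFun := lift β hβ
  map_add' := map_add _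
  map_smul' c t := by
    induction t using induction_on with
    | tmul m n => exact hD m n c
    | add x y hx hy => rw [smul_add, map_add, hx, hy, map_add, smul_add]

theorem liftRight_smul (β : M →ₗ[k] N →ₗ[k] P)
    (hβ : ∀ m (a : A) n, β (op a • m) n = β m (a • n))
    (hD : ∀ m n (c : Dᵐᵒᵖ), β m (c • n) = c • β m n) (c : k) (t : BalTensor k A M N) :
    liftRight β hβ hD (c • t) = c • liftRight β hβ hD t := (lift β hβ).map_smul c t

end Lift

end BalTensor

/-! ### The corner ring: noetherianity and dimension. -/

section Corner

variable {k : Type u} [Field k] {B : Type v} [Ring B] [Algebra k B] {e : B}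
  (he : IsIdempotentElem e)

/-- The projection `b ↦ ebe` of `B` onto the corner. -/
def cornerProj : B →ₗ[k] he.Corner where
  toFun b := ⟨e * b * e, (Subsemigroup.mem_corner_iff he).2
    ⟨by rw [← mul_assoc, ← mul_assoc, he.eq], by rw [mul_assoc, he.eq]⟩⟩
  map_add' x y := Subtype.ext (by
    change e * (x + y) * e = e * x * e + e * y * e
    rw [mul_add, add_mul])
  map_smul' c x := Subtype.ext (by
    change e * (c • x) * e = c • (e * x * e)
    rw [mul_smul_comm, smul_mul_assoc])

instance : IsScalarTower k he.Cornerᵐᵒᵖ he.Corner where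
  smul_assoc c a x := Subtype.ext (mul_smul_comm c x.1 (unop a).1)

/-- The map `I ↦ BI` on left ideals is strictly monotone, because `e(BI)e = I`: for `c ∈ I` one has
`e(bc)e = (ebe)c`. Ascending chains in `eBe` thus inherit termination from `B`. -/
theorem isNoetherianRing_corner {B : Type*} [Ring B] {e : B} (he : IsIdempotentElem e)
    [IsNoetherianRing B] : IsNoetherianRing he.Corner := by
  let pr (b : B) : he.Corner := ⟨e * b * e, (Subsemigroup.mem_corner_iff he).2
    ⟨by rw [← mul_assoc, ← mul_assoc, he.eq], by rw [mul_assoc, he.eq]⟩⟩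
  let F (I : Ideal he.Corner) : Ideal B := Ideal.span ((fun a : he.Corner => a.1) '' I)
  -- The quantifier over `b` carries the induction through scalar multiples: the multiplier is
  -- absorbed into `b`.
  have key (I : Ideal he.Corner) (x : B) (hx : x ∈ F I) : ∀ b, pr (b * x) ∈ I := by
    induction hx using Submodule.span_induction with
    | mem x hx =>
      obtain ⟨c, hc, rfl⟩ := hx
      intro b
      have : pr (b * c.1) = pr b * c := Subtype.ext (by
        change e * (b * c.1) * e = e * b * e * c.1
        rw [mul_assoc, mul_assoc b, Corner.right_eq, mul_assoc (e * b), Corner.left_eq, mul_assoc])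
      rw [this]
      exact I.mul_mem_left _ hc
    | zero =>
      intro b
      have : pr (b * 0) = 0 := Subtype.ext (by change e * (b * 0) * e = 0; simp)
      rw [this]
      exact I.zero_mem
    | add x y _ _ hx hy =>
      intro b
      have : pr (b * (x + y)) = pr (b * x) + pr (b * y) := Subtype.ext (by
        change e * (b * (x + y)) * e = e * (b * x) * e + e * (b * y) * e
        simp only [mul_add, add_mul])
      rw [this]
      exact I.add_mem (hx b) (hy b)
    | smul a x _ hx =>
      intro b
      rw [smul_eq_mul, ← mul_assoc]
      exact hx (b * a)
  have hF (I J : Ideal he.Corner) (h : F I ≤ F J) : I ≤ J := fun a ha => by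
    have h1 := key J a.1 (h (Ideal.subset_span ⟨a, ha, rfl⟩)) 1
    have : pr (1 * a.1) = a := Subtype.ext (by
      change e * (1 * a.1) * e = a.1
      rw [one_mul, Corner.left_eq, Corner.right_eq])
    rwa [this] at h1
  have hmono : StrictMono F := fun I J h => lt_of_le_not_ge
    (Ideal.span_mono (Set.image_mono h.le)) fun h' => h.not_ge (hF _ _ h')
  have : WellFoundedGT (Ideal B) := inferInstance
  have : WellFoundedGT (Ideal he.Corner) := hmono.wellFoundedGT
  exact isNoetherian_iff'.2 this

/-- The opposite of `eBe` is the corner of the opposite ring at `op e`. -/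
theorem isNoetherianRing_corner_op {B : Type*} [Ring B] {e : B} (he : IsIdempotentElem e)
    [IsNoetherianRing Bᵐᵒᵖ] : IsNoetherianRing he.Cornerᵐᵒᵖ := by
  have he' : IsIdempotentElem (op e) := congrArg op he.eq
  have := isNoetherianRing_corner he'
  let f : he'.Corner ≃+* he.Cornerᵐᵒᵖ :=
    { toFun a := op ⟨unop a.1, (Subsemigroup.mem_corner_iff he).2
        ⟨congrArg unop (Corner.right_eq he' a), congrArg unop (Corner.left_eq he' a)⟩⟩
      invFun a := ⟨op (unop a).1, (Subsemigroup.mem_corner_iff he').2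
        ⟨congrArg op (Corner.right_eq he (unop a)), congrArg op (Corner.left_eq he (unop a))⟩⟩
      left_inv _ := rfl
      right_inv _ := rfl
      map_mul' _ _ := rfl
      map_add' _ _ := rfl }
  exact isNoetherianRing_of_ringEquiv _ f

theorem gkDim_corner_le : gkDim k he.Cornerᵐᵒᵖ he.Corner ≤ gkDim k Bᵐᵒᵖ B :=
  gkDim_le_of_injective
    ((opLinearEquiv k).toLinearMap ∘ₗ Corner.incl he ∘ₗ (opLinearEquiv k).symm.toLinearMap)
    (Corner.incl he) Subtype.val_injective fun _ _ => rfl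

/-- Growth over `B` on the left is controlled by the commuting, finite right action of `eBe`. The
last comparison identifies the opposite of `eBe`, as a left module over itself, with the right
module `eBe`. -/
theorem gkDim_peirceLeft_le [Module.Finite he.Cornerᵐᵒᵖ ↥(peirceLeft e)] :
    gkDim k B ↥(peirceLeft e) ≤ gkDim k he.Cornerᵐᵒᵖ he.Corner :=
  (gkDim_le_of_finite_bimodule (S := he.Cornerᵐᵒᵖ)).trans <|
    gkDim_le_of_injective LinearMap.id (opLinearEquiv k).symm.toLinearMap
      (opLinearEquiv k).symm.injective fun _ _ => rfl

end Corner

/-! ### The two multiplication maps, their kernels and cokernels. -/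

section Multiplication

variable (k : Type u) [Field k] {B : Type v} [Ring B] [Algebra k B] {e : B}
  (he : IsIdempotentElem e)

/-- The multiplication map `Be ⊗ eB → B`, over the corner `eBe`. -/
def mulToRing : BalTensor k he.Corner ↥(peirceLeft e) ↥(peirceRight e) →ₗ[Bᵐᵒᵖ] B :=
  BalTensor.liftRight
    (LinearMap.mk₂ k (fun (x : ↥(peirceLeft e)) (y : ↥(peirceRight e)) => x.1 * y.1)
      (fun x x' y => add_mul x.1 x'.1 y.1) (fun c x y => smul_mul_assoc c x.1 y.1)
      (fun x y y' => mul_add x.1 y.1 y'.1) (fun c x y => mul_smul_comm c x.1 y.1))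
    (fun x a y => mul_assoc x.1 a.1 y.1) (fun x y c => (mul_assoc x.1 y.1 (unop c)).symm)

/-- The multiplication map `eB ⊗ Be → eBe`, over `B`. -/
def mulToCorner : BalTensor k B ↥(peirceRight e) ↥(peirceLeft e) →ₗ[he.Cornerᵐᵒᵖ] he.Corner :=
  BalTensor.liftRight
    (LinearMap.mk₂ k (fun (x : ↥(peirceRight e)) (y : ↥(peirceLeft e)) =>
        (⟨x.1 * y.1, (Subsemigroup.mem_corner_iff he).2
          ⟨by rw [← mul_assoc, (mem_peirceRight he).1 x.2],
            by rw [mul_assoc, (mem_peirceLeft he).1 y.2]⟩⟩ : he.Corner))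
      (fun x x' y => Subtype.ext (add_mul x.1 x'.1 y.1))
      (fun c x y => Subtype.ext (smul_mul_assoc c x.1 y.1))
      (fun x y y' => Subtype.ext (mul_add x.1 y.1 y'.1))
      (fun c x y => Subtype.ext (mul_smul_comm c x.1 y.1)))
    (fun x a y => Subtype.ext (mul_assoc x.1 a y.1))
    (fun x y c => Subtype.ext (mul_assoc x.1 y.1 (unop c).1).symm)

@[simp]
theorem mulToRing_tmul (x : ↥(peirceLeft e)) (y : ↥(peirceRight e)) :
    mulToRing k he (BalTensor.tmul k he.Corner x y) = x.1 * y.1 := rfl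

theorem mulToRing_smul (b : B)
    (t : BalTensor k he.Corner ↥(peirceLeft e) ↥(peirceRight e)) :
    mulToRing k he (b • t) = b • mulToRing k he t := by
  induction t using BalTensor.induction_on with
  | tmul x y => exact mul_assoc b x.1 y.1
  | add x y hx hy => rw [smul_add, map_add, hx, hy, map_add, smul_add]

theorem mulToCorner_smul (a : he.Corner)
    (t : BalTensor k B ↥(peirceRight e) ↥(peirceLeft e)) :
    mulToCorner k he (a • t) = a • mulToCorner k he t := by
  induction t using BalTensor.induction_on with
  | tmul x y => exact Subtype.ext (mul_assoc a.1 x.1 y.1)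
  | add x y hx hy => rw [smul_add, map_add, hx, hy, map_add, smul_add]

/-- On `t = x' ⊗ y'`, the element `y'x` lies in `eBe` and crosses the tensor sign: `x' ⊗ (y'x)y =
x'(y'x) ⊗ y = (x'y')x ⊗ y`. Hence right multiplication by `xy` depends on `t` only through its
product. -/
theorem mul_smul_eq_tmul (x : ↥(peirceLeft e)) (y : ↥(peirceRight e))
    (t : BalTensor k he.Corner ↥(peirceLeft e) ↥(peirceRight e)) :
    op (x.1 * y.1) • t = BalTensor.tmul k he.Corner (mulToRing k he t • x) y := by
  induction t using BalTensor.induction_on with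
  | tmul x' y' =>
    let a : he.Corner := ⟨y'.1 * x.1, (Subsemigroup.mem_corner_iff he).2
      ⟨by rw [← mul_assoc, (mem_peirceRight he).1 y'.2],
        by rw [mul_assoc, (mem_peirceLeft he).1 x.2]⟩⟩
    have h1 : op (x.1 * y.1) • y' = a • y := Subtype.ext (mul_assoc y'.1 x.1 y.1).symm
    have h2 : mulToRing k he (BalTensor.tmul k he.Corner x' y') • x = op a • x' :=
      Subtype.ext (mul_assoc x'.1 y'.1 x.1)
    rw [BalTensor.smul_tmul_right, h1, h2, BalTensor.smul_tmul]
  | add t t' h h' => rw [smul_add, h, h', map_add, add_smul, BalTensor.add_tmul]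

/-- The generators of `BeB` are products `(xe)e` with `xe ∈ Be` and `e ∈ eB`, so `mul_smul_eq_tmul`
makes them kill every `t` with zero product. -/
theorem idealBeB_smul_eq_zero {b : B} (hb : b ∈ idealBeB e)
    {t : BalTensor k he.Corner ↥(peirceLeft e) ↥(peirceRight e)} (ht : mulToRing k he t = 0) :
    op b • t = 0 := by
  induction hb using Submodule.span_induction with
  | mem b hb =>
    obtain ⟨x, rfl⟩ := hb
    have := mul_smul_eq_tmul k he ⟨x * e, (mem_peirceLeft he).2 (by rw [mul_assoc, he.eq])⟩
      ⟨e, (mem_peirceRight he).2 he.eq⟩ t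
    rw [ht, zero_smul, BalTensor.zero_tmul] at this
    simpa [mul_assoc, he.eq] using this
  | zero => rw [op_zero, zero_smul]
  | add x y _ _ hx hy => rw [op_add, add_smul, hx, hy, add_zero]
  | smul c x _ hx =>
    have : op (c • x) = c * op x := rfl
    rw [this, mul_smul, hx, smul_zero]

theorem range_mulToRing : LinearMap.range (mulToRing k he) = idealBeB e := by
  refine le_antisymm ?_ (Submodule.span_le.2 ?_)
  · rintro _ ⟨t, rfl⟩
    induction t using BalTensor.induction_on with
    | tmul x y =>
      rw [mulToRing_tmul, ← (mem_peirceLeft he).1 x.2]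
      exact Submodule.smul_mem _ (op y.1) (Submodule.subset_span ⟨x.1, rfl⟩)
    | add x y hx hy => rw [map_add]; exact add_mem hx hy
  · rintro _ ⟨x, rfl⟩
    exact ⟨BalTensor.tmul k he.Corner ⟨x * e, (mem_peirceLeft he).2 (by rw [mul_assoc, he.eq])⟩
      ⟨e, (mem_peirceRight he).2 he.eq⟩, by simp [mul_assoc, he.eq]⟩

/-- `eB` is generated by `e` over `B`, so generators `x` of `Be` over `eBe` give generators `x ⊗ e`.
-/
theorem finite_tensor_corner [Module.Finite he.Cornerᵐᵒᵖ ↥(peirceLeft e)] :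
    Module.Finite Bᵐᵒᵖ (BalTensor k he.Corner ↥(peirceLeft e) ↥(peirceRight e)) := by
  obtain ⟨s, hs⟩ := (Module.finite_def (R := he.Cornerᵐᵒᵖ) (M := ↥(peirceLeft e))).1 ‹_›
  let y₀ : ↥(peirceRight e) := ⟨e, (mem_peirceRight he).2 he.eq⟩
  have hy (y : ↥(peirceRight e)) : y = op y.1 • y₀ := Subtype.ext ((mem_peirceRight he).1 y.2).symm
  let T := (fun x => BalTensor.tmul k he.Corner x y₀) '' (s : Set ↥(peirceLeft e))
  refine Module.finite_def.2 (Submodule.fg_def.2 ⟨T, s.finite_toSet.image _, ?_⟩)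
  refine eq_top_iff.2 fun t ht => ?_
  clear ht
  induction t using BalTensor.induction_on with
  | tmul x y =>
    have hx : x ∈ Submodule.span he.Cornerᵐᵒᵖ (s : Set ↥(peirceLeft e)) :=
      hs ▸ Submodule.mem_top
    -- A scalar from `eBe` moves across the tensor sign and changes `y`.
    induction hx using Submodule.span_induction generalizing y with
    | mem x hx =>
      rw [hy y, ← BalTensor.smul_tmul_right]
      exact Submodule.smul_mem _ _ (Submodule.subset_span ⟨x, hx, rfl⟩)
    | zero => rw [BalTensor.zero_tmul]; exact zero_mem _
    | add x x' _ _ hx hx' => rw [BalTensor.add_tmul]; exact add_mem (hx y) (hx' y)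
    | smul a x _ hx =>
      have := BalTensor.smul_tmul (k := k) x (unop a) y
      rw [op_unop] at this
      rw [this]
      exact hx _
  | add x y hx hy => exact add_mem hx hy

/-- A finitely generated right module killed by a right ideal `I` has dimension at most that of
`B / I`. -/
theorem gkDim_le_of_smul_eq_zero {X : Type*} [AddCommGroup X] [Module k X] [Module Bᵐᵒᵖ X]
    [IsScalarTower k Bᵐᵒᵖ X] [Module.Finite Bᵐᵒᵖ X] (I : Submodule Bᵐᵒᵖ B)
    (h : ∀ b ∈ I, ∀ x : X, op b • x = 0) : gkDim k Bᵐᵒᵖ X ≤ gkDim k Bᵐᵒᵖ (B ⧸ I) := by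
  obtain ⟨l, g, hg⟩ := Module.Finite.exists_fin (R := Bᵐᵒᵖ) (M := X)
  let orbit (x : X) : B →ₗ[Bᵐᵒᵖ] X :=
    { toFun b := op b • x
      map_add' b c := add_smul (op b) (op c) x
      map_smul' c b := mul_smul c (op b) x }
  -- Each orbit map of a generator factors through `B / I`, and together they cover `X`.
  refine gkDim_le_of_jointly_surjective
    (fun i : Fin l => I.liftQ (orbit (g i)) fun b hb => h b hb _) fun x => ?_
  have hx : x ∈ Submodule.span Bᵐᵒᵖ (Set.range g) := hg ▸ Submodule.mem_top
  obtain ⟨c, hc⟩ := (Submodule.mem_span_range_iff_exists_fun Bᵐᵒᵖ).1 hx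
  exact ⟨fun i => I.mkQ (unop (c i)), hc.symm⟩

theorem isSIso_mulToRing [IsNoetherianRing Bᵐᵒᵖ] [Module.Finite he.Cornerᵐᵒᵖ ↥(peirceLeft e)]
    {s : EReal} (hs : gkDim k Bᵐᵒᵖ (B ⧸ idealBeB e) ≤ s) : IsSIso k B s (mulToRing k he) := by
  have hcoker (I : Submodule Bᵐᵒᵖ B) (hI : I = idealBeB e) : gkDim k Bᵐᵒᵖ (B ⧸ I) ≤ s := by
    rwa [hI]
  refine ⟨?_, hcoker _ (range_mulToRing k he)⟩
  have := finite_tensor_corner k he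
  have : Module.Finite Bᵐᵒᵖ ↥(LinearMap.ker (mulToRing k he)) := inferInstance
  exact (gkDim_le_of_smul_eq_zero k (idealBeB e) fun b hb t =>
    Subtype.ext (idealBeB_smul_eq_zero k he hb t.2)).trans hs

theorem isSIso_of_bijective {A : Type*} [Ring A] [Algebra k A] (s : EReal) {X P : Type*}
    [AddCommGroup X] [Module k X] [Module Aᵐᵒᵖ X] [IsScalarTower k Aᵐᵒᵖ X]
    [AddCommGroup P] [Module k P] [Module Aᵐᵒᵖ P] [IsScalarTower k Aᵐᵒᵖ P]
    (f : X →ₗ[Aᵐᵒᵖ] P) (hf : Function.Bijective f) : IsSIso k A s f := by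
  have : Subsingleton ↥(LinearMap.ker f) :=
    Submodule.subsingleton_iff_eq_bot.2 (LinearMap.ker_eq_bot.2 hf.1)
  have : Subsingleton (P ⧸ LinearMap.range f) :=
    Submodule.Quotient.subsingleton_iff.2 (LinearMap.range_eq_top.2 hf.2)
  exact ⟨gkDim_of_subsingleton.le.trans bot_le, gkDim_of_subsingleton.le.trans bot_le⟩

/-- Since `x = e · x` with `x ∈ B`, every tensor satisfies `x ⊗ y = e ⊗ xy` and is determined by its
product. -/
theorem mulToCorner_bijective : Function.Bijective (mulToCorner k he) := by
  let x₀ : ↥(peirceRight e) := ⟨e, (mem_peirceRight he).2 he.eq⟩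
  have key (t : BalTensor k B ↥(peirceRight e) ↥(peirceLeft e)) :
      t = BalTensor.tmul k B x₀ ⟨(mulToCorner k he t).1, (mem_peirceLeft he).2
        (Corner.right_eq he _)⟩ := by
    induction t using BalTensor.induction_on with
    | tmul x y =>
      have hx : x = op x.1 • x₀ := Subtype.ext ((mem_peirceRight he).1 x.2).symm
      conv_lhs => rw [hx, BalTensor.smul_tmul]
      rfl
    | add t t' h h' =>
      conv_lhs => rw [h, h', ← BalTensor.tmul_add]
      congr 1
      refine Subtype.ext ?_
      rw [map_add]
      rfl
  refine ⟨fun t t' h => ?_, fun a => ⟨BalTensor.tmul k B x₀ ⟨a.1, (mem_peirceLeft he).2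
    (Corner.right_eq he a)⟩, Subtype.ext (Corner.left_eq he a)⟩⟩
  rw [key t, key t']
  simp only [h]

end Multiplication

/-! ### Induced gradings and homogeneity of multiplication. -/

section Gradings

variable {k : Type u} [Field k]

theorem isInternal_intGrading {X : Type*} [AddCommGroup X] [Module k X] {𝒳 : ℕ → Submodule k X}
    (h : DirectSum.IsInternal 𝒳) : DirectSum.IsInternal (intGrading 𝒳) := by
  rw [DirectSum.isInternal_submodule_iff_iSupIndep_and_iSup_eq_top] at h ⊢
  refine ⟨fun i => ?_, eq_top_iff.2 (h.2.symm.le.trans (iSup_le fun n =>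
    le_iSup (intGrading 𝒳) (Int.ofNat n)))⟩
  cases i with
  | ofNat n =>
    refine (h.1 n).mono_right (iSup₂_le fun j hj => ?_)
    cases j with
    | ofNat m => exact le_iSup₂_of_le m (fun hm => hj (congrArg Int.ofNat hm)) le_rfl
    | negSucc m => exact bot_le
  | negSucc n => exact disjoint_bot_left

/-- A grading restricts to a direct summand whose projection preserves degrees. -/
theorem isInternal_comap {ι X Y : Type*} [DecidableEq ι] [AddCommGroup X] [Module k X]
    [AddCommGroup Y] [Module k Y] {𝒳 : ι → Submodule k X} (h : DirectSum.IsInternal 𝒳)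
    (f : Y →ₗ[k] X) (p : X →ₗ[k] Y) (hpf : ∀ y, p (f y) = y)
    (hfp : ∀ i, ∀ x ∈ 𝒳 i, f (p x) ∈ 𝒳 i) :
    DirectSum.IsInternal fun i => (𝒳 i).comap f := by
  rw [DirectSum.isInternal_submodule_iff_iSupIndep_and_iSup_eq_top] at h ⊢
  constructor
  · intro i
    refine Submodule.disjoint_def.2 fun y hy hy' => ?_
    have h1 : f y ∈ ⨆ j, ⨆ (_ : j ≠ i), 𝒳 j := by
      refine (Submodule.map_le_iff_le_comap.1 ?_ :
        ⨆ j, ⨆ (_ : j ≠ i), (𝒳 j).comap f ≤ (⨆ j, ⨆ (_ : j ≠ i), 𝒳 j).comap f) hy'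
      simp only [Submodule.map_iSup]
      exact iSup₂_mono fun j _ => Submodule.map_comap_le _ _
    have h2 : f y = 0 := Submodule.disjoint_def.1 (h.1 i) _ hy h1
    rw [← hpf y, h2, map_zero]
  · refine eq_top_iff.2 fun y _ => ?_
    have hy : p (f y) ∈ (⨆ i, 𝒳 i).map p := Submodule.mem_map_of_mem (h.2 ▸ Submodule.mem_top)
    rw [hpf, Submodule.map_iSup] at hy
    refine (iSup_le fun i => ?_ : ⨆ i, (𝒳 i).map p ≤ ⨆ i, (𝒳 i).comap f) hy
    refine le_trans ?_ (le_iSup _ i)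
    rintro _ ⟨x, hx, rfl⟩
    exact hfp i x hx

theorem mul_mem_intGrading {B : Type*} [Ring B] [Algebra k B] {ℬ : ℕ → Submodule k B}
    (hℬ : IsLocallyFiniteGrading k ℬ) {p q : ℤ} {x y : B} (hx : x ∈ intGrading ℬ p)
    (hy : y ∈ intGrading ℬ q) : x * y ∈ intGrading ℬ (p + q) := by
  cases p with
  | negSucc p => rw [(Submodule.mem_bot k).1 hx, zero_mul]; exact zero_mem _
  | ofNat p =>
    cases q with
    | negSucc q => rw [(Submodule.mem_bot k).1 hy, mul_zero]; exact zero_mem _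
    | ofNat q => exact hℬ.mul_mem hx hy

theorem IsLocallyFiniteGrading.isGradedBimodule {B : Type*} [Ring B] [Algebra k B]
    {ℬ : ℕ → Submodule k B} (hℬ : IsLocallyFiniteGrading k ℬ) :
    IsGradedBimodule ℬ ℬ (intGrading ℬ) where
  isInternal := isInternal_intGrading hℬ.isInternal
  left_smul_mem i _ _ _ ha hx := mul_mem_intGrading hℬ (p := Int.ofNat i) ha hx
  right_smul_mem i _ _ _ ha hx := mul_mem_intGrading hℬ (q := Int.ofNat i) hx ha

variable {B : Type v} [Ring B] [Algebra k B] {ℬ : ℕ → Submodule k B} {e : B}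

/-- The projection `b ↦ ebe` splits the inclusion and preserves degrees because `e` has degree 0;
also, `e` is the unit of `eBe`. -/
theorem isLocallyFiniteGrading_cornerGrading (hℬ : IsLocallyFiniteGrading k ℬ)
    (he : IsIdempotentElem e) (h0 : e ∈ ℬ 0) :
    IsLocallyFiniteGrading k (cornerGrading he ℬ) where
  one_mem := h0
  mul_mem _ _ _ _ ha hb := hℬ.mul_mem ha hb
  isInternal := isInternal_comap hℬ.isInternal (Corner.incl he) (cornerProj he)
    (fun a => Subtype.ext (by
      change e * a.1 * e = a.1
      rw [Corner.left_eq, Corner.right_eq]))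
    (fun i x hx => by
      have := hℬ.mul_mem (hℬ.mul_mem h0 hx) h0
      rwa [zero_add, add_zero] at this)
  finite i := by
    have := hℬ.finite i
    exact Module.Finite.of_injective ((Corner.incl he).restrict (p := cornerGrading he ℬ i)
      (q := ℬ i) fun _ hx => hx) fun x y h =>
        Subtype.ext (Subtype.ext (congrArg (fun z : ↥(ℬ i) => z.1) h))

theorem isGradedBimodule_leftGrading (hℬ : IsLocallyFiniteGrading k ℬ)
    (he : IsIdempotentElem e) (h0 : e ∈ ℬ 0) :
    IsGradedBimodule ℬ (cornerGrading he ℬ) (leftGrading ℬ e) where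
  isInternal := isInternal_comap (isInternal_intGrading hℬ.isInternal)
    ((peirceLeft e).subtype.restrictScalars k)
    { toFun b := ⟨b * e, (mem_peirceLeft he).2 (by rw [mul_assoc, he.eq])⟩
      map_add' b c := Subtype.ext (add_mul b c e)
      map_smul' c b := Subtype.ext (smul_mul_assoc c b e) }
    (fun x => Subtype.ext ((mem_peirceLeft he).1 x.2))
    (fun i x hx => by simpa using mul_mem_intGrading hℬ hx (q := Int.ofNat 0) h0)
  left_smul_mem i _ _ _ ha hx := mul_mem_intGrading hℬ (p := Int.ofNat i) ha hx
  right_smul_mem i _ _ _ ha hx := mul_mem_intGrading hℬ (q := Int.ofNat i) hx ha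

theorem isGradedBimodule_rightGrading (hℬ : IsLocallyFiniteGrading k ℬ)
    (he : IsIdempotentElem e) (h0 : e ∈ ℬ 0) :
    IsGradedBimodule (cornerGrading he ℬ) ℬ (rightGrading ℬ e) where
  isInternal := isInternal_comap (isInternal_intGrading hℬ.isInternal)
    ((peirceRight e).subtype.restrictScalars k)
    { toFun b := ⟨e * b, (mem_peirceRight he).2 (by rw [← mul_assoc, he.eq])⟩
      map_add' b c := Subtype.ext (mul_add e b c)
      map_smul' c b := Subtype.ext (mul_smul_comm c e b) }
    (fun x => Subtype.ext ((mem_peirceRight he).1 x.2))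
    (fun i x hx => by simpa using mul_mem_intGrading hℬ (p := Int.ofNat 0) h0 hx)
  left_smul_mem i _ _ _ ha hx := mul_mem_intGrading hℬ (p := Int.ofNat i) ha hx
  right_smul_mem i _ _ _ ha hx := mul_mem_intGrading hℬ (q := Int.ofNat i) hx ha

theorem mulToRing_mem (hℬ : IsLocallyFiniteGrading k ℬ) (he : IsIdempotentElem e) (i : ℤ)
    (t : BalTensor k he.Corner ↥(peirceLeft e) ↥(peirceRight e))
    (ht : t ∈ tensorGrading (A := he.Corner) (leftGrading ℬ e) (rightGrading ℬ e) i) :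
    mulToRing k he t ∈ intGrading ℬ i := by
  induction ht using Submodule.span_induction with
  | mem t ht =>
    obtain ⟨p, q, rfl, x, hx, y, hy, rfl⟩ := ht
    exact mul_mem_intGrading hℬ hx hy
  | zero => rw [map_zero]; exact zero_mem _
  | add x y _ _ hx hy => rw [map_add]; exact add_mem hx hy
  | smul c x _ hx =>
    have : mulToRing k he (c • x) = c • mulToRing k he x :=
      BalTensor.liftRight_smul _ _ _ c x
    rw [this]
    exact Submodule.smul_mem _ c hx

theorem intGrading_cornerGrading (he : IsIdempotentElem e) (i : ℤ) :
    intGrading (cornerGrading he ℬ) i = (intGrading ℬ i).comap (Corner.incl he) := by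
  cases i with
  | ofNat n => rfl
  -- In negative degrees the right side is the kernel of the inclusion, which is zero.
  | negSucc n => exact (LinearMap.ker_eq_bot.2 Subtype.val_injective).symm

theorem mulToCorner_mem (hℬ : IsLocallyFiniteGrading k ℬ) (he : IsIdempotentElem e) (i : ℤ)
    (t : BalTensor k B ↥(peirceRight e) ↥(peirceLeft e))
    (ht : t ∈ tensorGrading (A := B) (rightGrading ℬ e) (leftGrading ℬ e) i) :
    mulToCorner k he t ∈ intGrading (cornerGrading he ℬ) i := by
  rw [intGrading_cornerGrading]
  induction ht using Submodule.span_induction with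
  | mem t ht =>
    obtain ⟨p, q, rfl, x, hx, y, hy, rfl⟩ := ht
    exact mul_mem_intGrading hℬ hx hy
  | zero => rw [map_zero]; exact zero_mem _
  | add x y _ _ hx hy => rw [map_add]; exact add_mem hx hy
  | smul c x _ hx =>
    have : mulToCorner k he (c • x) = c • mulToCorner k he x :=
      BalTensor.liftRight_smul _ _ _ c x
    rw [this]
    exact Submodule.smul_mem _ c hx

end Gradings

/-! ### The ring-theoretic conditions and the conclusion. -/

theorem idempotent_ne_zero {k : Type u} [Field k] {B : Type v} [Ring B] [Algebra k B] {d : ℕ}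
    (hd : gkDim k Bᵐᵒᵖ B = d) {e : B}
    (hGK : gkDim k Bᵐᵒᵖ (B ⧸ idealBeB e) ≤ (((d : ℝ) - 2 : ℝ) : EReal)) : e ≠ 0 := by
  rintro rfl
  have hI : idealBeB (0 : B) = ⊥ := by
    refine le_bot_iff.1 (Submodule.span_le.2 ?_)
    rintro _ ⟨x, rfl⟩
    simp
  -- If `e = 0` then `B / BeB` is `B`, which would give `d ≤ d - 2`.
  have h1 : gkDim k Bᵐᵒᵖ B ≤ gkDim k Bᵐᵒᵖ (B ⧸ idealBeB (0 : B)) :=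
    gkDim_le_of_jointly_surjective
      (fun _ : Unit => ((idealBeB (0 : B)).quotEquivOfEqBot hI).toLinearMap) fun b =>
        ⟨fun _ => (idealBeB (0 : B)).mkQ b, by simp⟩
  rw [hd] at h1
  have h2 : ((d : ℝ) : EReal) ≤ (((d : ℝ) - 2 : ℝ) : EReal) := h1.trans hGK
  have h3 := EReal.coe_le_coe_iff.1 h2
  linarith

theorem quasiResolutionData_peirce {k : Type u} [Field k] {B : Type v} [Ring B] [Algebra k B]
    (hl : IsNoetherianRing B) (hr : IsNoetherianRing Bᵐᵒᵖ) {d : ℕ} (hd : 2 ≤ d)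
    (hreg : IsAuslanderRegular B) (hCM : IsCohenMacaulay B k d)
    {e : B} (he : IsIdempotentElem e)
    (hBe : Module.Finite B ↥(peirceLeft e))
    (hBe' : Module.Finite he.Cornerᵐᵒᵖ ↥(peirceLeft e))
    (heB : Module.Finite he.Corner ↥(peirceRight e))
    (heB' : Module.Finite Bᵐᵒᵖ ↥(peirceRight e))
    (hGK : gkDim k Bᵐᵒᵖ (B ⧸ idealBeB e) ≤ (((d : ℝ) - 2 : ℝ) : EReal)) :
    QuasiResolutionData k B he.Corner ↥(peirceLeft e) ↥(peirceRight e) d where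
  two_le := hd
  left_noetherian_base := isNoetherianRing_corner he
  right_noetherian_base := isNoetherianRing_corner_op he
  gkDim_base := by
    refine le_antisymm ((gkDim_corner_le he).trans hCM.gkDim_eq.le) ?_
    -- The lower bound passes through the nonzero left ideal `Be`: it has dimension `d` over `B` and
    -- is finite over `eBe`.
    rw [← hCM.left_cm.gkDim_leftIdeal (peirceLeft e) (mt Submodule.span_singleton_eq_bot.1
      (idempotent_ne_zero (k := k) hCM.gkDim_eq hGK))]
    exact gkDim_peirceLeft_le he
  left_noetherian := hl
  right_noetherian := hr
  auslanderRegular := hreg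
  cohenMacaulay := hCM
  finite_left_M := hBe
  finite_right_M := hBe'
  finite_left_N := heB
  finite_right_N := heB'

end QuasiRes

theorem proposition8p3 {k : Type*} [Field k] {B : Type*} [Ring B] [Algebra k B]
    (ℬ : ℕ → Submodule k B) (hℬ : QuasiRes.IsLocallyFiniteGrading k ℬ)
    (hl : IsNoetherianRing B) (hr : IsNoetherianRing Bᵐᵒᵖ)
    (d : ℕ) (hd : 2 ≤ d)
    (hreg : QuasiRes.IsAuslanderRegular B) (hCM : QuasiRes.IsCohenMacaulay B k d)
    {e : B} (he : IsIdempotentElem e)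
    (hBe : Module.Finite B ↥(QuasiRes.peirceLeft e))
    (hBe' : Module.Finite he.Cornerᵐᵒᵖ ↥(QuasiRes.peirceLeft e))
    (heB : Module.Finite he.Corner ↥(QuasiRes.peirceRight e))
    (heB' : Module.Finite Bᵐᵒᵖ ↥(QuasiRes.peirceRight e))
    (hGK : QuasiRes.gkDim k Bᵐᵒᵖ (B ⧸ QuasiRes.idealBeB e) ≤ (((d : ℝ) - 2 : ℝ) : EReal)) :
    QuasiRes.IsNQR k B he.Corner ↥(QuasiRes.peirceLeft e) ↥(QuasiRes.peirceRight e) d ∧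
    (e ∈ ℬ 0 →
      QuasiRes.IsGradedNQR ℬ (QuasiRes.cornerGrading he ℬ)
        (QuasiRes.leftGrading ℬ e) (QuasiRes.rightGrading ℬ e) d) := by

  have data := QuasiRes.quasiResolutionData_peirce hl hr hd hreg hCM he hBe hBe' heB heB' hGK
  have hB := QuasiRes.isSIso_mulToRing k he hGK
  have hB' : QuasiRes.IsSIso k B (((d : ℝ) - 2 : ℝ) : EReal)
      (LinearMap.id : B →ₗ[Bᵐᵒᵖ] B) :=
    QuasiRes.isSIso_of_bijective k _ _ Function.bijective_id
  have hA : QuasiRes.IsSIso k he.Corner (((d : ℝ) - 2 : ℝ) : EReal)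
      (QuasiRes.mulToCorner k he) :=
    QuasiRes.isSIso_of_bijective k _ _ (QuasiRes.mulToCorner_bijective k he)
  have hA' : QuasiRes.IsSIso k he.Corner (((d : ℝ) - 2 : ℝ) : EReal)
      (LinearMap.id : he.Corner →ₗ[he.Cornerᵐᵒᵖ] he.Corner) :=
    QuasiRes.isSIso_of_bijective k _ _ Function.bijective_id
  refine ⟨⟨data, ?_, ?_⟩, fun h0 => ⟨data,
    QuasiRes.isLocallyFiniteGrading_cornerGrading hℬ he h0, hℬ,
    QuasiRes.isGradedBimodule_leftGrading hℬ he h0,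
    QuasiRes.isGradedBimodule_rightGrading hℬ he h0, ?_, ?_⟩⟩
  -- The intermediate bimodule is `B`, reached by multiplication from the tensor product and by the
  -- identity from `B`; the other cases have the same shape.
  · exact ⟨B, inferInstance, inferInstance, inferInstance, inferInstance, inferInstance,
      inferInstance, inferInstance, QuasiRes.mulToRing k he, LinearMap.id,
      QuasiRes.mulToRing_smul k he, fun _ _ => rfl, hB, hB'⟩
  · exact ⟨he.Corner, inferInstance, inferInstance, inferInstance, inferInstance, inferInstance,
      inferInstance, inferInstance, QuasiRes.mulToCorner k he, LinearMap.id,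
      QuasiRes.mulToCorner_smul k he, fun _ _ => rfl, hA, hA'⟩
  · exact ⟨B, inferInstance, inferInstance, inferInstance, inferInstance, inferInstance,
      inferInstance, inferInstance, QuasiRes.intGrading ℬ, QuasiRes.mulToRing k he,
      LinearMap.id, hℬ.isGradedBimodule, QuasiRes.mulToRing_smul k he, fun _ _ => rfl,
      QuasiRes.mulToRing_mem hℬ he, fun _ _ hy => hy, hB, hB'⟩
  · exact ⟨he.Corner, inferInstance, inferInstance, inferInstance, inferInstance, inferInstance,
      inferInstance, inferInstance, QuasiRes.intGrading (QuasiRes.cornerGrading he ℬ),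
      QuasiRes.mulToCorner k he, LinearMap.id,
      (QuasiRes.isLocallyFiniteGrading_cornerGrading hℬ he h0).isGradedBimodule,
      QuasiRes.mulToCorner_smul k he, fun _ _ => rfl,
      QuasiRes.mulToCorner_mem hℬ he, fun _ _ hy => hy, hA, hA'⟩
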